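/- Consider an exchange economy with a finite set $N=\{1,\dots,N\}$ of agents and a nonempty finite state space $S$. Agent $i$ has an endowment $\omega_i\in\mathbb{R}_+^S$ and a utility function $V_i:\mathbb{R}_+^S\to\mathbb{R}$ with $V_i(x)=x$ for every constant bundle $x\in\mathbb{R}_+$ (risk neutrality). There is no aggregate uncertainty: $\sum_i\omega_i=\bar\omega$ for a constant $\bar\omega>0$. An allocation $(f_1,\dots,f_N)$, $f_i\in\mathbb{R}_+^S$, is *feasible* if $\sum_i f_i=\bar\omega$; *interior* if $f_i(s)>0$ for all $i$ and $s$; *full-insurance* if each $f_i$ is a constant $x_i\in\mathbb{R}_+$; *Pareto-efficient* if it is feasible and no feasible $(g_i)_i$ satisfies $V_i(g_i)\ge V_i(f_i)$ for all $i$ and $V_j(g_j)>V_j(f_j)$ for some $j$; a *competitive equilibrium with transfers* if it is feasible and there are prices $q\in\mathbb{R}_{++}^S$ and transfers $(T_i)_i\in\mathbb{R}^N$ with $\sum_iT_i=0$ such that, for every $i$, $f_i$ maximizes $V_i$ over $\{g\in\mathbb{R}_+^S: q\cdot g\le q\cdot\omega_i+T_i\}$. For $f\in\mathbb{R}_+^S$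 let $$\pi_i(f)=\{p\in\Delta(S):\ \forall g\in\mathbb{R}_+^S,\ V_i(g)\ge V_i(f)\Rightarrow p\cdot g\ge p\cdot f\}$$ be the set of supporting probabilities. Suppose that each $V_i$ is *nice*: locally Lipschitz, strictly monotone ($f\ge g$, $f\ne g$ imply $V_i(f)>V_i(g)$) and, for every constant $x>0$, continuously differentiable in a neighbourhood of $x$ with $\nabla V_i(x)\neq0$. Suppose also that each $V_i$ is *constant superadditive*, $V_i(f+k)\ge V_i(f)+k$ for all $f\in\mathbb{R}_+^S$ and constants $k\ge0$, and *positively subhomogeneous*, $V_i(\gamma f)\ge\gamma V_i(f)$ for all $f\in\mathbb{R}_+^S$ and $\gamma\in(0,1)$, and that for each $i$ at least one of the two is strict, that is, holds with strict inequality for all non-constant $f$ (and all $k>0$, respectively all $\gamma\in(0,1)$). Then the following are equivalent: (i) every Pareto-efficient allocation is a full-insurance allocation; (ii) every feasible full-insurance allocation is Pareto-efficient; (iii) for every feasible full-insurance allocation $(x_1,\dots,x_N)$, $\bigcap_{i\in N}\pi_i(x_i)\neq\emptyset$. Furthermore, under these equivalent conditions, every interior, feasible, full-insurance allocation is a competitive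 equilibrium with transfers. -/

import Mathlib

namespace RiskSharing

/-- The consumption set `ℝ_+^S`. A utility function on `ℝ_+^S` is represented by a function
`V : (S → ℝ) → ℝ`; every definition below uses only its values on `orthant S` (the differentiability
requirements are imposed at interior points of the orthant). -/
def orthant (S : Type*) : Set (S → ℝ) := {f | ∀ s, 0 ≤ f s}

/-- The constant (riskless) bundle that pays `x` in every state. -/
def cst (S : Type*) (x : ℝ) : S → ℝ := fun _ => x

/-- A bundle is constant if it pays the same amount in every state. -/
def IsConst {S : Type*} (f : S → ℝ) : Prop := ∃ x : ℝ, f = cst S x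

/-- Risk neutrality: `V(x) = x` for every constant `x ∈ ℝ_+`. -/
def Normalized {S : Type*} (V : (S → ℝ) → ℝ) : Prop :=
  ∀ x : ℝ, 0 ≤ x → V (cst S x) = x

/-- `V` is constant superadditive: `V(f + k) ≥ V(f) + k` for `f ∈ ℝ_+^S`, `k ≥ 0`. -/
def ConstSuperadditive {S : Type*} (V : (S → ℝ) → ℝ) : Prop :=
  ∀ f ∈ orthant S, ∀ k : ℝ, 0 ≤ k → V f + k ≤ V (f + cst S k)

/-- Strict constant superadditivity: strict inequality for non-constant `f` and `k > 0`
(for constant `f` a normalized `V` always gives equality). -/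
def StrictConstSuperadditive {S : Type*} (V : (S → ℝ) → ℝ) : Prop :=
  ConstSuperadditive V ∧
    ∀ f ∈ orthant S, ¬ IsConst f → ∀ k : ℝ, 0 < k → V f + k < V (f + cst S k)

/-- `V` is positively subhomogeneous: `V(γ f) ≥ γ V(f)` for `f ∈ ℝ_+^S`, `γ ∈ (0,1)`. -/
def PosSubhomogeneous {S : Type*} (V : (S → ℝ) → ℝ) : Prop :=
  ∀ f ∈ orthant S, ∀ γ : ℝ, 0 < γ → γ < 1 → γ * V f ≤ V (γ • f)

/-- Strict positive subhomogeneity: strict inequality for non-constant `f`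
(for constant `f` a normalized `V` always gives equality). -/
def StrictPosSubhomogeneous {S : Type*} (V : (S → ℝ) → ℝ) : Prop :=
  PosSubhomogeneous V ∧
    ∀ f ∈ orthant S, ¬ IsConst f → ∀ γ : ℝ, 0 < γ → γ < 1 → γ * V f < V (γ • f)

/-- `V` is nice: locally Lipschitz and strictly monotone on `ℝ_+^S` and, for every constant `x > 0`,
continuously differentiable in a neighbourhood of `x` with nonzero gradient at `x`. -/
structure Nice {S : Type*} [Fintype S] (V : (S → ℝ) → ℝ) : Prop where
  locallyLipschitz : LocallyLipschitzOn (orthant S) V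
  strictMono : StrictMonoOn V (orthant S)
  contDiffAt : ∀ x : ℝ, 0 < x → ContDiffAt ℝ 1 V (cst S x)
  gradient_ne_zero : ∀ x : ℝ, 0 < x → fderiv ℝ V (cst S x) ≠ 0

/-- Supporting probabilities of a utility function `V` at the bundle `f`. -/
def supportingProbs {S : Type*} [Fintype S] (V : (S → ℝ) → ℝ) (f : S → ℝ) : Set (S → ℝ) :=
  {p | p ∈ stdSimplex ℝ S ∧ ∀ g ∈ orthant S, V f ≤ V g → p ⬝ᵥ f ≤ p ⬝ᵥ g}

section Allocations

variable {I S : Type*} [Fintype I]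

/-- Feasible allocations when the aggregate endowment is the constant `w`. -/
def Feasible (w : ℝ) (f : I → S → ℝ) : Prop :=
  (∀ i, f i ∈ orthant S) ∧ ∑ i, f i = cst S w

/-- Interior allocations. -/
def Interior (f : I → S → ℝ) : Prop := ∀ i s, 0 < f i s

/-- Full-insurance allocations. -/
def FullInsurance (f : I → S → ℝ) : Prop := ∀ i, ∃ x : ℝ, 0 ≤ x ∧ f i = cst S x

/-- Pareto-efficient allocations. -/
def ParetoEfficient (V : I → (S → ℝ) → ℝ) (w : ℝ) (f : I → S → ℝ) : Prop :=
  Feasible w f ∧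
    ¬ ∃ g : I → S → ℝ, Feasible w g ∧ (∀ i, V i (f i) ≤ V i (g i)) ∧ ∃ j, V j (f j) < V j (g j)

/-- Budget set at prices `q`, endowment `e` and transfer `t`. -/
def budgetSet [Fintype S] (q e : S → ℝ) (t : ℝ) : Set (S → ℝ) :=
  {g | g ∈ orthant S ∧ q ⬝ᵥ g ≤ q ⬝ᵥ e + t}

/-- Competitive equilibria with transfers, at strictly positive prices and with transfers
(of either sign) that sum to zero. -/
def CompetitiveEquilibriumWithTransfers [Fintype S] (V : I → (S → ℝ) → ℝ) (ω : I → S → ℝ) (w : ℝ)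
    (f : I → S → ℝ) : Prop :=
  Feasible w f ∧
    ∃ q : S → ℝ, (∀ s, 0 < q s) ∧
      ∃ T : I → ℝ, ∑ i, T i = 0 ∧
        ∀ i, f i ∈ budgetSet q (ω i) (T i) ∧ ∀ g ∈ budgetSet q (ω i) (T i), V i g ≤ V i (f i)

/-- Every Pareto-efficient allocation is a full-insurance allocation. -/
def EfficientIsFullInsurance (V : I → (S → ℝ) → ℝ) (w : ℝ) : Prop :=
  ∀ f : I → S → ℝ, ParetoEfficient V w f → FullInsurance f

/-- Every feasible full-insurance allocation is Pareto-efficient. -/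
def FullInsuranceIsEfficient (V : I → (S → ℝ) → ℝ) (w : ℝ) : Prop :=
  ∀ f : I → S → ℝ, Feasible w f → FullInsurance f → ParetoEfficient V w f

/-- At every feasible full-insurance allocation the agents share a supporting probability. -/
def SharedSupportingProbs [Fintype S] (V : I → (S → ℝ) → ℝ) (w : ℝ) : Prop :=
  ∀ f : I → S → ℝ, Feasible w f → FullInsurance f →
    (⋂ i, supportingProbs (V i) (f i)).Nonempty

end Allocations

end RiskSharing

open RiskSharing

/-! Mixing a bundle with certainty costs no utility relative to linear interpolation
(`le_apply_smul_add_cst`), so near certainty a utility behaves as if quasiconcave: its gradient at a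
constant bundle is a supporting probability. (i) ⇒ (ii): by compactness an allocation dominating a
full-insurance one is itself weakly dominated by an efficient, hence constant, one; but normalized
utilities of constant feasible allocations sum to `w`. (ii) ⇒ (iii): two agents with different
gradients at positive constants could trade a little and both gain, so all such gradients agree; at
zero every probability supports. (iii) ⇒ (i): for efficient `f`, shared probabilities force the
utilities `V i (f i)` to sum to `w`. At the full-insurance allocation paying these utilities, a
shared `p` then prices each `f i` at exactly its utility, while strictness makes nonconstant bundles
dearer (`lt_dotProduct_of_not_isConst`). -/

namespace RiskSharing

open Filter Topology

/-! ### Bundles and mixtures with certainty -/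

section Bundles

variable {S : Type*}

theorem cst_mem_orthant {x : ℝ} (hx : 0 ≤ x) : cst S x ∈ orthant S := fun _ => hx

theorem smul_mem_orthant {f : S → ℝ} (hf : f ∈ orthant S) {c : ℝ} (hc : 0 ≤ c) :
    c • f ∈ orthant S := fun s => mul_nonneg hc (hf s)

theorem add_mem_orthant {f g : S → ℝ} (hf : f ∈ orthant S) (hg : g ∈ orthant S) :
    f + g ∈ orthant S := fun s => add_nonneg (hf s) (hg s)

theorem isClosed_orthant : IsClosed (orthant S) := by
  simp only [orthant, Set.ofPred_forall]
  exact isClosed_iInter fun s => isClosed_le continuous_const (continuous_apply s)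

theorem dotProduct_cst [Fintype S] {p : S → ℝ} (hp : ∑ s, p s = 1) (x : ℝ) :
    p ⬝ᵥ cst S x = x := by
  simp [dotProduct, cst, ← Finset.sum_mul, hp]

theorem dotProduct_nonneg_of_mem [Fintype S] {p f : S → ℝ} (hp : ∀ s, 0 ≤ p s)
    (hf : f ∈ orthant S) : 0 ≤ p ⬝ᵥ f :=
  Finset.sum_nonneg fun s _ => mul_nonneg (hp s) (hf s)

/-- Two distinct probability vectors are strictly separated through the origin. -/
theorem exists_dotProduct_pos_neg [Fintype S] {p q : S → ℝ} (hp : ∑ s, p s = 1)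
    (hq : ∑ s, q s = 1) (hne : p ≠ q) : ∃ d : S → ℝ, 0 < p ⬝ᵥ d ∧ q ⬝ᵥ d < 0 := by
  have h : 0 < (p - q) ⬝ᵥ (p - q) := by
    obtain ⟨s, hs⟩ := Function.ne_iff.mp (sub_ne_zero.mpr hne)
    exact Finset.sum_pos' (fun s _ => mul_self_nonneg _)
      ⟨s, Finset.mem_univ s, mul_self_pos.mpr hs⟩
  rw [sub_dotProduct] at h
  -- Subtracting a constant lowers both pairings equally; the midpoint of the two values leaves them
  -- with opposite signs.
  refine ⟨(p - q) - cst S ((p ⬝ᵥ (p - q) + q ⬝ᵥ (p - q)) / 2), ?_, ?_⟩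
  · rw [dotProduct_sub, dotProduct_cst hp]; linarith
  · rw [dotProduct_sub, dotProduct_cst hq]; linarith

/-- Utility along a segment towards certainty dominates the linear interpolation. -/
theorem le_apply_smul_add_cst {V : (S → ℝ) → ℝ} (hcs : ConstSuperadditive V) (hps : PosSubhomogeneous V)
    {g : S → ℝ} (hg : g ∈ orthant S) {γ x : ℝ} (h0 : 0 < γ) (h1 : γ < 1) (hx : 0 ≤ x) :
    γ * V g + (1 - γ) * x ≤ V (γ • g + cst S ((1 - γ) * x)) := by
  have h2 := hcs _ (smul_mem_orthant hg h0.le) ((1 - γ) * x)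
    (mul_nonneg (by linarith) hx)
  have h3 := hps g hg γ h0 h1
  linarith

theorem not_isConst_smul {g : S → ℝ} (hg : ¬ IsConst g) {γ : ℝ} (hγ : γ ≠ 0) :
    ¬ IsConst (γ • g) := by
  rintro ⟨x, hx⟩
  refine hg ⟨γ⁻¹ * x, ?_⟩
  rw [← inv_smul_smul₀ hγ g, hx]
  rfl

theorem FullInsurance.eq_cst {I : Type*} {f : I → S → ℝ} (hf : FullInsurance f) :
    ∃ x : I → ℝ, (∀ i, 0 ≤ x i) ∧ f = fun i => cst S (x i) := by
  choose x hx using hf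
  exact ⟨x, fun i => (hx i).1, funext fun i => (hx i).2⟩

theorem lt_apply_smul_add_cst {V : (S → ℝ) → ℝ} (hcs : ConstSuperadditive V) (hps : PosSubhomogeneous V)
    (hst : StrictConstSuperadditive V ∨ StrictPosSubhomogeneous V)
    {g : S → ℝ} (hg : g ∈ orthant S) (hgc : ¬ IsConst g) {γ x : ℝ} (h0 : 0 < γ) (h1 : γ < 1)
    (hx : 0 < x) : γ * V g + (1 - γ) * x < V (γ • g + cst S ((1 - γ) * x)) := by
  have hk : 0 < (1 - γ) * x := mul_pos (by linarith) hx
  have hm := smul_mem_orthant hg h0.le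
  rcases hst with h | h
  · have h2 := h.2 _ hm (not_isConst_smul hgc h0.ne') _ hk
    have h3 := hps g hg γ h0 h1
    linarith
  · have h2 := hcs _ hm _ hk.le
    have h3 := h.2 g hg hgc γ h0 h1
    linarith

end Bundles

/-! ### Consequences of niceness and normalization -/

section Utility

variable {S : Type*} [Fintype S] {V : (S → ℝ) → ℝ}

theorem Nice.continuousOn (hV : Nice V) : ContinuousOn V (orthant S) :=
  hV.locallyLipschitz.continuousOn

theorem Normalized.nonneg (hn : Normalized V) (hV : Nice V) {f : S → ℝ} (hf : f ∈ orthant S) :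
    0 ≤ V f := by
  rw [← hn 0 le_rfl]
  exact hV.strictMono.monotoneOn (cst_mem_orthant le_rfl) hf fun s => hf s

theorem Normalized.eq_zero (hn : Normalized V) (hV : Nice V) {f : S → ℝ} (hf : f ∈ orthant S)
    (h : V f = 0) : f = 0 := by
  by_contra h0
  have hlt : cst S 0 < f := lt_of_le_of_ne (fun s => hf s) (Ne.symm h0)
  have := hV.strictMono (cst_mem_orthant le_rfl) hf hlt
  rw [hn 0 le_rfl] at this
  linarith

theorem Nice.exists_smul_lt (hV : Nice V) {g : S → ℝ} (hg : g ∈ orthant S) {c : ℝ}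
    (hc : c < V g) : ∃ γ : ℝ, 0 < γ ∧ γ < 1 ∧ c < V (γ • g) := by
  have hcont : ContinuousWithinAt (fun γ : ℝ => V (γ • g)) (Set.Ici 0) 1 := by
    refine ContinuousWithinAt.comp (t := orthant S) (g := V) ?_ (by fun_prop)
      fun γ hγ => smul_mem_orthant hg hγ
    simpa using hV.continuousOn g hg
  have hev : ∀ᶠ γ : ℝ in 𝓝 1, c < V (γ • g) := by
    have h1 : 𝓝[Set.Ici (0 : ℝ)] 1 = 𝓝 1 := nhdsWithin_eq_nhds.mpr (Ici_mem_nhds one_pos)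
    rw [← h1]
    exact hcont.eventually_const_lt (by simpa using hc)
  have hpos : ∀ᶠ γ : ℝ in 𝓝 1, 0 < γ := eventually_gt_nhds one_pos
  obtain ⟨γ, ⟨h1, h2⟩, h3⟩ :=
    (((hev.and hpos).filter_mono nhdsWithin_le_nhds).and
      (self_mem_nhdsWithin : Set.Iio (1 : ℝ) ∈ 𝓝[<] 1)).exists
  exact ⟨γ, h2, h3, h1⟩

/-! ### Supporting probabilities at constant bundles -/

section Supporting

variable {p : S → ℝ} {x : ℝ}

theorem le_dotProduct_of_mem_supportingProbs (hn : Normalized V) (hx : 0 ≤ x)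
    (hp : p ∈ supportingProbs V (cst S x)) {g : S → ℝ} (hg : g ∈ orthant S) (h : x ≤ V g) :
    x ≤ p ⬝ᵥ g := by
  have := hp.2 g hg (by rwa [hn x hx])
  rwa [dotProduct_cst hp.1.2] at this

/-- A strictly better bundle stays better after a slight shrinking, and shrinking strictly lowers a
positive cost. -/
theorem lt_dotProduct_of_lt (hn : Normalized V) (hV : Nice V) (hx : 0 ≤ x)
    (hp : p ∈ supportingProbs V (cst S x)) {g : S → ℝ} (hg : g ∈ orthant S) (h : x < V g)
    (hpos : 0 < p ⬝ᵥ g) : x < p ⬝ᵥ g := by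
  obtain ⟨γ, h0, h1, hγ⟩ := hV.exists_smul_lt hg h
  have := le_dotProduct_of_mem_supportingProbs hn hx hp (smul_mem_orthant hg h0.le) hγ.le
  rw [dotProduct_smul, smul_eq_mul] at this
  nlinarith

theorem lt_dotProduct_of_lt_of_pos (hn : Normalized V) (hV : Nice V) (hx : 0 < x)
    (hp : p ∈ supportingProbs V (cst S x)) {g : S → ℝ} (hg : g ∈ orthant S) (h : x < V g) :
    x < p ⬝ᵥ g :=
  lt_dotProduct_of_lt hn hV hx.le hp hg h
    (hx.trans_le (le_dotProduct_of_mem_supportingProbs hn hx.le hp hg h.le))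

/-- The even mixture of `g` with `x` is strictly better than `x`, so it costs more than `x`; its
cost is the average of `x` and the cost of `g`. -/
theorem lt_dotProduct_of_not_isConst (hn : Normalized V) (hV : Nice V)
    (hcs : ConstSuperadditive V) (hps : PosSubhomogeneous V)
    (hst : StrictConstSuperadditive V ∨ StrictPosSubhomogeneous V) (hx : 0 < x)
    (hp : p ∈ supportingProbs V (cst S x)) {g : S → ℝ} (hg : g ∈ orthant S) (h : x ≤ V g)
    (hgc : ¬ IsConst g) : x < p ⬝ᵥ g := by
  have h1 := lt_apply_smul_add_cst hcs hps hst hg hgc (γ := 1 / 2) (by norm_num) (by norm_num) hx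
  have h2 := lt_dotProduct_of_lt_of_pos hn hV hx hp
    (add_mem_orthant (smul_mem_orthant hg (c := 1 / 2) (by norm_num))
      (cst_mem_orthant (x := (1 - 1 / 2) * x) (by linarith))) (by linarith)
  rw [dotProduct_add, dotProduct_smul, dotProduct_cst hp.1.2, smul_eq_mul] at h2
  linarith

theorem Nice.lt_apply_cst_add_single [DecidableEq S] (hn : Normalized V) (hV : Nice V)
    (hx : 0 ≤ x) (s : S) : x < V (cst S x + Pi.single s 1) := by
  have hsingle : (0 : S → ℝ) < Pi.single s 1 := by
    simp
  have := hV.strictMono (cst_mem_orthant hx)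
    (add_mem_orthant (cst_mem_orthant hx) fun t => hsingle.le t) (lt_add_of_pos_right _ hsingle)
  rwa [hn x hx] at this

theorem supportingProbs_pos (hn : Normalized V) (hV : Nice V) (hx : 0 < x)
    (hp : p ∈ supportingProbs V (cst S x)) (s : S) : 0 < p s := by
  classical
  have h2 := lt_dotProduct_of_lt_of_pos hn hV hx hp
    (add_mem_orthant (cst_mem_orthant hx.le)
      fun t => (Pi.single_nonneg.mpr zero_le_one : (0 : S → ℝ) ≤ Pi.single s 1) t)
    (hV.lt_apply_cst_add_single hn hx.le s)
  rw [dotProduct_add, dotProduct_cst hp.1.2, dotProduct_single, mul_one] at h2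
  linarith

theorem mem_supportingProbs_zero (hp : p ∈ stdSimplex ℝ S) :
    p ∈ supportingProbs V (cst S 0) :=
  ⟨hp, fun g hg _ => by
    rw [dotProduct_cst hp.2]; exact dotProduct_nonneg_of_mem hp.1 hg⟩

end Supporting

/-! ### Gradients at certainty -/

section Gradient

variable {x : ℝ}

theorem Nice.hasFDerivAt (hV : Nice V) (hx : 0 < x) :
    HasFDerivAt V (fderiv ℝ V (cst S x)) (cst S x) :=
  ((hV.contDiffAt x hx).differentiableAt one_ne_zero).hasFDerivAt

theorem eventually_lt_of_hasFDerivAt {E : Type*} [NormedAddCommGroup E] [NormedSpace ℝ E]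
    {F : E → ℝ} {D : E →L[ℝ] ℝ} {a d : E} (h : HasFDerivAt F D a) (hd : 0 < D d) :
    ∀ᶠ t : ℝ in 𝓝[>] 0, F a < F (a + t • d) := by
  have h1 : HasDerivAt (fun t : ℝ => F (a + t • d)) (D d) 0 := h.hasLineDerivAt d
  have h2 := (hasDerivAt_iff_tendsto_slope.mp h1).mono_left
    (nhdsWithin_mono 0 fun t (ht : 0 < t) => ht.ne')
  filter_upwards [h2.eventually_const_lt hd, self_mem_nhdsWithin] with t ht (h0 : 0 < t)
  rw [slope_def_field] at ht
  have := (div_pos_iff_of_pos_right (by simpa using h0)).mp ht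
  simpa using this

/-- Were the derivative negative, a small move from `x` towards `g` would push utility below `x`,
against the interpolation bound. -/
theorem fderiv_sub_nonneg (hn : Normalized V) (hV : Nice V)
    (hcs : ConstSuperadditive V) (hps : PosSubhomogeneous V) (hx : 0 < x)
    {g : S → ℝ} (hg : g ∈ orthant S) (h : x ≤ V g) :
    0 ≤ fderiv ℝ V (cst S x) (g - cst S x) := by
  by_contra hneg
  have h1 := eventually_lt_of_hasFDerivAt (d := g - cst S x) (hV.hasFDerivAt hx).neg
    (by simpa using hneg)
  have h2 : ∀ᶠ t : ℝ in 𝓝[>] 0, t < 1 := (eventually_lt_nhds one_pos).filter_mono nhdsWithin_le_nhds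
  obtain ⟨t, ⟨ht, ht1⟩, ht0⟩ := ((h1.and h2).and self_mem_nhdsWithin).exists
  have ht0 : 0 < t := ht0
  have h3 := le_apply_smul_add_cst hcs hps hg ht0 ht1 hx.le
  have h4 : cst S x + t • (g - cst S x) = t • g + cst S ((1 - t) * x) := by
    ext s; simp [cst]; ring
  simp only [Pi.neg_apply, h4, hn x hx.le] at ht
  nlinarith

/-- The gradient of a utility function at a riskless bundle. -/
noncomputable def certaintyGradient [DecidableEq S] (V : (S → ℝ) → ℝ) (x : ℝ) : S → ℝ :=
  fun s => fderiv ℝ V (cst S x) (Pi.single s 1)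

theorem certaintyGradient_dotProduct [DecidableEq S] (d : S → ℝ) :
    certaintyGradient V x ⬝ᵥ d = fderiv ℝ V (cst S x) d := by
  conv_rhs => rw [pi_eq_sum_univ' d]
  simp [dotProduct, certaintyGradient, mul_comm, Pi.single]

/-- Along the constant direction `V` is `x + t` by normalization. This makes the entries of the
gradient sum to one. -/
theorem fderiv_one (hn : Normalized V) (hV : Nice V) (hx : 0 < x) :
    fderiv ℝ V (cst S x) (cst S 1) = 1 := by
  have h1 : HasDerivAt (fun t : ℝ => V (cst S x + t • cst S 1)) (fderiv ℝ V (cst S x) (cst S 1)) 0 :=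
    (hV.hasFDerivAt hx).hasLineDerivAt _
  have h2 : HasDerivAt (fun t : ℝ => x + t) 1 0 := (hasDerivAt_id (0 : ℝ)).const_add x
  refine h1.unique (h2.congr_of_eventuallyEq ?_)
  filter_upwards [eventually_gt_nhds (neg_lt_zero.mpr hx)] with t ht
  have h3 : cst S x + t • cst S 1 = cst S (x + t) := by ext s; simp [cst]
  rw [h3, hn _ (by linarith)]

theorem certaintyGradient_mem_supportingProbs [DecidableEq S] (hn : Normalized V) (hV : Nice V)
    (hcs : ConstSuperadditive V) (hps : PosSubhomogeneous V) (hx : 0 < x) :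
    certaintyGradient V x ∈ supportingProbs V (cst S x) := by
  refine ⟨⟨fun s => ?_, ?_⟩, fun g hg h => ?_⟩
  · have := fderiv_sub_nonneg hn hV hcs hps hx
      (add_mem_orthant (cst_mem_orthant hx.le)
        fun t => (Pi.single_nonneg.mpr zero_le_one : (0 : S → ℝ) ≤ Pi.single s 1) t)
      (hV.lt_apply_cst_add_single hn hx.le s).le
    rwa [add_sub_cancel_left] at this
  · rw [← fderiv_one hn hV hx, ← certaintyGradient_dotProduct]
    simp [dotProduct, cst]
  · have := fderiv_sub_nonneg hn hV hcs hps hx hg (by rwa [hn x hx.le] at h)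
    rw [← certaintyGradient_dotProduct, dotProduct_sub] at this
    linarith

end Gradient

end Utility

/-! ### Allocations and the equivalences -/

section Economy

variable {I S : Type*} [Fintype I] {V : I → (S → ℝ) → ℝ} {w : ℝ}

theorem sum_eq_of_feasible_cst [Nonempty S] {x : I → ℝ}
    (h : Feasible w fun i => cst S (x i)) : ∑ i, x i = w := by
  simpa [cst] using congrFun h.2 (Classical.arbitrary S)

theorem feasible_cst {x : I → ℝ} (hx : ∀ i, 0 ≤ x i) (h : ∑ i, x i = w) :
    Feasible w fun i => cst S (x i) :=
  ⟨fun i => cst_mem_orthant (hx i), by ext s; simp [cst, h]⟩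

theorem exists_pos_of_sum_pos {x : I → ℝ} (h : 0 < ∑ i, x i) : ∃ i, 0 < x i := by
  obtain ⟨i, -, hi⟩ := Finset.exists_lt_of_sum_lt (s := Finset.univ) (f := 0) (g := x) (by simpa)
  exact ⟨i, hi⟩

theorem sum_dotProduct_of_feasible [Fintype S] {p : S → ℝ} (hp : ∑ s, p s = 1) {f : I → S → ℝ}
    (hf : Feasible w f) : ∑ i, p ⬝ᵥ f i = w := by
  rw [← dotProduct_sum, hf.2, dotProduct_cst hp]

theorem isCompact_feasible [Fintype S] : IsCompact {f : I → S → ℝ | Feasible w f} := by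
  have hcl : IsClosed {f : I → S → ℝ | Feasible w f} := by
    simp only [Feasible, Set.ofPred_and, Set.ofPred_forall]
    refine (isClosed_iInter fun i => isClosed_orthant.preimage (continuous_apply i)).inter
      (isClosed_eq ?_ continuous_const)
    exact continuous_finsetSum _ fun i _ => continuous_apply i
  refine IsCompact.of_isClosed_subset
    (isCompact_Icc (a := (0 : I → S → ℝ)) (b := fun _ => cst S w)) hcl fun f hf =>
      ⟨fun i s => hf.1 i s, fun i s => ?_⟩
  change f i s ≤ cst S w s
  rw [← hf.2, Finset.sum_apply]
  exact Finset.single_le_sum (f := fun i => f i s) (fun i _ => hf.1 i s) (Finset.mem_univ i)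

/-- Every feasible allocation is weakly dominated by an efficient one. -/
theorem exists_paretoEfficient_ge [Fintype S] (hV : ∀ i, Nice (V i)) {g : I → S → ℝ}
    (hg : Feasible w g) : ∃ h, ParetoEfficient V w h ∧ ∀ i, V i (g i) ≤ V i (h i) := by
  have hcont : ∀ i, ContinuousOn (fun f : I → S → ℝ => V i (f i)) {f | Feasible w f} := fun i =>
    (hV i).continuousOn.comp (continuous_apply i).continuousOn fun f hf => hf.1 i
  have hK : IsCompact ({f : I → S → ℝ | Feasible w f} ∩ {f | ∀ i, V i (g i) ≤ V i (f i)}) := by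
    refine isCompact_feasible.of_isClosed_subset ?_ Set.inter_subset_left
    have : {f : I → S → ℝ | Feasible w f} ∩ {f | ∀ i, V i (g i) ≤ V i (f i)} =
        {f : I → S → ℝ | Feasible w f} ∩ (fun f i => V i (f i)) ⁻¹' Set.Ici fun i => V i (g i) :=
      rfl
    rw [this]
    exact (continuousOn_pi.mpr hcont).preimage_isClosed_of_isClosed
      isCompact_feasible.isClosed isClosed_Ici
  -- Maximize the sum of utilities over the feasible allocations weakly dominating `g`.
  obtain ⟨h, ⟨hf, hge⟩, hmax⟩ := hK.exists_isMaxOn ⟨g, hg, fun i => le_rfl⟩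
    (f := fun f => ∑ i, V i (f i))
    (continuousOn_finsetSum _ fun i _ => (hcont i).mono Set.inter_subset_left)
  refine ⟨h, ⟨hf, ?_⟩, hge⟩
  rintro ⟨k, hk, hle, j, hj⟩
  have h1 : ∑ i, V i (k i) ≤ ∑ i, V i (h i) := hmax ⟨hk, fun i => (hge i).trans (hle i)⟩
  exact absurd (Finset.sum_lt_sum (fun i _ => hle i) ⟨j, Finset.mem_univ j, hj⟩) h1.not_gt

theorem EfficientIsFullInsurance.fullInsuranceIsEfficient [Fintype S] [Nonempty S]
    (hn : ∀ i, Normalized (V i)) (hV : ∀ i, Nice (V i)) (H : EfficientIsFullInsurance V w) :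
    FullInsuranceIsEfficient V w := by
  intro f hf hfi
  refine ⟨hf, ?_⟩
  rintro ⟨g, hg, hle, j, hj⟩
  obtain ⟨h, hh, hge⟩ := exists_paretoEfficient_ge hV hg
  obtain ⟨x, hx, rfl⟩ := hfi.eq_cst
  obtain ⟨y, hy, rfl⟩ := (H h hh).eq_cst
  simp only [hn _ _ (hx _), hn _ _ (hy _)] at hle hj hge
  have := Finset.sum_lt_sum (fun i _ => (hle i).trans (hge i))
    ⟨j, Finset.mem_univ j, hj.trans_le (hge j)⟩
  rw [sum_eq_of_feasible_cst hf, sum_eq_of_feasible_cst hh.1] at this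
  exact lt_irrefl _ this

theorem FullInsuranceIsEfficient.certaintyGradient_eq [Fintype S] [DecidableEq S]
    (hn : ∀ i, Normalized (V i)) (hV : ∀ i, Nice (V i)) (hcs : ∀ i, ConstSuperadditive (V i))
    (hps : ∀ i, PosSubhomogeneous (V i)) (H : FullInsuranceIsEfficient V w) {x : I → ℝ}
    (hx : ∀ i, 0 ≤ x i) (hf : Feasible w fun i => cst S (x i)) {i j : I} (hi : 0 < x i)
    (hj : 0 < x j) : certaintyGradient (V i) (x i) = certaintyGradient (V j) (x j) := by
  classical
  by_contra hne
  have hij : i ≠ j := by rintro rfl; exact hne rfl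
  have hsum : ∀ k, 0 < x k → ∑ s, certaintyGradient (V k) (x k) s = 1 := fun k hk =>
    (certaintyGradient_mem_supportingProbs (hn k) (hV k) (hcs k) (hps k) hk).1.2
  obtain ⟨d, hd1, hd2⟩ := exists_dotProduct_pos_neg (hsum i hi) (hsum j hj) hne
  rw [certaintyGradient_dotProduct] at hd1 hd2
  have hmem : ∀ k, 0 < x k → ∀ e : S → ℝ,
      ∀ᶠ t : ℝ in 𝓝[>] 0, cst S (x k) + t • e ∈ orthant S := by
    intro k hk e
    refine (eventually_all.mpr fun s => ?_).filter_mono nhdsWithin_le_nhds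
    have hc : Continuous fun t : ℝ => (cst S (x k) + t • e) s := by
      simp only [Pi.add_apply, Pi.smul_apply]; fun_prop
    have := (hc.tendsto 0).eventually_const_lt (u := 0) (by simpa [cst] using hk)
    exact this.mono fun t ht => ht.le
  obtain ⟨t, ⟨⟨h1, h2⟩, h3⟩, h4⟩ := (((eventually_lt_of_hasFDerivAt ((hV i).hasFDerivAt hi) hd1).and
    (eventually_lt_of_hasFDerivAt (d := -d) ((hV j).hasFDerivAt hj) (by simpa using hd2))).and
    (hmem i hi d) |>.and (hmem j hj (-d))).exists
  -- The improving trade: `j` hands `t • d` to `i`, and nobody else is affected.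
  refine (H _ hf fun k => ⟨x k, hx k, rfl⟩).2
    ⟨fun k => cst S (x k) + (if k = i then t • d else 0) + (if k = j then t • -d else 0),
      ⟨fun k => ?_, ?_⟩, fun k => ?_, i, ?_⟩
  · by_cases hki : k = i
    · subst hki; simpa [hij] using h3
    · by_cases hkj : k = j
      · subst hkj; simpa [hki] using h4
      · simpa [hki, hkj] using hf.1 k
  · rw [Finset.sum_add_distrib, Finset.sum_add_distrib, hf.2]
    simp
  · by_cases hki : k = i
    · subst hki; simpa [hij] using h1.le
    · by_cases hkj : k = j
      · subst hkj; simpa [hki] using h2.le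
      · simp [hki, hkj]
  · simpa [hij] using h1

theorem FullInsuranceIsEfficient.sharedSupportingProbs [Fintype S] [Nonempty S]
    (hw : 0 < w) (hn : ∀ i, Normalized (V i)) (hV : ∀ i, Nice (V i))
    (hcs : ∀ i, ConstSuperadditive (V i)) (hps : ∀ i, PosSubhomogeneous (V i))
    (H : FullInsuranceIsEfficient V w) : SharedSupportingProbs V w := by
  classical
  intro f hf hfi
  obtain ⟨x, hx, rfl⟩ := hfi.eq_cst
  obtain ⟨j, hj⟩ := exists_pos_of_sum_pos (hw.trans_eq (sum_eq_of_feasible_cst hf).symm)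
  have hmem := fun k (hk : 0 < x k) =>
    certaintyGradient_mem_supportingProbs (hn k) (hV k) (hcs k) (hps k) hk
  refine ⟨certaintyGradient (V j) (x j), Set.mem_iInter.mpr fun i => ?_⟩
  rcases (hx i).eq_or_lt with h0 | hi
  · simp only [← h0]
    exact mem_supportingProbs_zero (hmem j hj).1
  · rw [← H.certaintyGradient_eq hn hV hcs hps hx hf hi hj]
    exact hmem i hi

theorem SharedSupportingProbs.efficientIsFullInsurance [Fintype S] [Nonempty S]
    (hw : 0 < w) (hn : ∀ i, Normalized (V i)) (hV : ∀ i, Nice (V i))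
    (hcs : ∀ i, ConstSuperadditive (V i)) (hps : ∀ i, PosSubhomogeneous (V i))
    (hst : ∀ i, StrictConstSuperadditive (V i) ∨ StrictPosSubhomogeneous (V i))
    (H : SharedSupportingProbs V w) : EfficientIsFullInsurance V w := by
  intro f hf
  obtain ⟨hff, hpe⟩ := hf
  set c : I → ℝ := fun i => V i (f i) with hc
  have hc0 : ∀ i, 0 ≤ c i := fun i => (hn i).nonneg (hV i) (hff.1 i)
  have hshared : ∀ y : I → ℝ, (∀ i, 0 ≤ y i) → ∑ i, y i = w →
      ∃ p : S → ℝ, ∀ i, p ∈ supportingProbs (V i) (cst S (y i)) := fun y hy hs =>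
    (H _ (feasible_cst hy hs) fun i => ⟨y i, hy i, rfl⟩).imp fun p hp => Set.mem_iInter.mp hp
  have hI : Nonempty I := by
    by_contra h
    rw [not_nonempty_iff] at h
    have := congrFun hff.2 (Classical.arbitrary S)
    simp [cst] at this
    exact hw.ne this
  have i₀ : I := Classical.arbitrary I
  have hle : ∑ i, c i ≤ w := by
    by_contra! hlt
    have hcpos : 0 < ∑ i, c i := hw.trans hlt
    -- If utilities sum to more than `w`, scale them down to a feasible full-insurance allocation.
    -- Subhomogeneity gives `V i (r • f i) ≥ r * c i`, so its shared `p` prices each `f i` at `c i`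
    -- or more, exceeding `w` in total.
    set r := w / ∑ i, c i with hr
    have hr0 : 0 < r := div_pos hw hcpos
    have hr1 : r < 1 := (div_lt_one hcpos).mpr hlt
    obtain ⟨p, hp⟩ := hshared (fun i => r * c i) (fun i => mul_nonneg hr0.le (hc0 i))
      (by rw [← Finset.mul_sum, hr, div_mul_cancel₀ _ hcpos.ne'])
    have h1 : ∀ i, c i ≤ p ⬝ᵥ f i := fun i => by
      have := le_dotProduct_of_mem_supportingProbs (hn i) (mul_nonneg hr0.le (hc0 i)) (hp i)
        (smul_mem_orthant (hff.1 i) hr0.le) (hps i _ (hff.1 i) r hr0 hr1)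
      rw [dotProduct_smul, smul_eq_mul] at this
      exact le_of_mul_le_mul_left this hr0
    have h2 := Finset.sum_le_sum fun i (_ : i ∈ Finset.univ) => h1 i
    rw [sum_dotProduct_of_feasible (hp i₀).1.2 hff] at h2
    linarith
  have hN : (0 : ℝ) < Fintype.card I := by exact_mod_cast Fintype.card_pos
  have heq : ∑ i, c i = w := by
    by_contra hne
    have hpos : 0 < (w - ∑ i, c i) / Fintype.card I :=
      div_pos (sub_pos.mpr (lt_of_le_of_ne hle hne)) hN
    -- If utilities sum to less than `w`, certain payments with the shortfall split equally make
    -- everyone better off.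
    set y : I → ℝ := fun i => c i + (w - ∑ i, c i) / Fintype.card I with hy
    have hcy : ∀ i, c i < y i := fun i => lt_add_of_pos_right _ hpos
    have hy0 : ∀ i, 0 ≤ y i := fun i => (hc0 i).trans (hcy i).le
    have hlt : ∀ i, V i (f i) < V i (cst S (y i)) := fun i => by
      rw [hn i _ (hy0 i)]; exact hcy i
    refine hpe ⟨fun i => cst S (y i), feasible_cst hy0 ?_, fun i => (hlt i).le, i₀, hlt i₀⟩
    simp only [hy, Finset.sum_add_distrib, Finset.sum_const, Finset.card_univ, nsmul_eq_mul]
    field_simp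
    ring
  obtain ⟨p, hp⟩ := hshared c hc0 heq
  have h1 : ∀ i, c i ≤ p ⬝ᵥ f i := fun i =>
    le_dotProduct_of_mem_supportingProbs (hn i) (hc0 i) (hp i) (hff.1 i) le_rfl
  have h2 : ∀ i, c i = p ⬝ᵥ f i := by
    have := (Finset.sum_eq_sum_iff_of_le fun i (_ : i ∈ Finset.univ) => h1 i).mp
      (by rw [heq, sum_dotProduct_of_feasible (hp i₀).1.2 hff])
    exact fun i => this i (Finset.mem_univ i)
  intro i
  -- The strict cost bound needs positive utility; zero utility forces the zero bundle by strict
  -- monotonicity.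
  rcases (hc0 i).eq_or_lt with h0 | hi
  · exact ⟨0, le_rfl, (hn i).eq_zero (hV i) (hff.1 i) h0.symm⟩
  · by_cases hconst : IsConst (f i)
    · obtain ⟨x, hx⟩ := hconst
      refine ⟨x, ?_, hx⟩
      have := hff.1 i (Classical.arbitrary S)
      rwa [hx] at this
    · have := lt_dotProduct_of_not_isConst (hn i) (hV i) (hcs i) (hps i) (hst i) hi (hp i)
        (hff.1 i) le_rfl hconst
      exact absurd (h2 i) this.ne

/-- Interior full-insurance allocations with a shared supporting probability are decentralized by
it. -/
theorem SharedSupportingProbs.competitiveEquilibrium [Fintype S] [Nonempty S]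
    {ω : I → S → ℝ} (hw : 0 < w) (hagg : ∑ i, ω i = cst S w)
    (hn : ∀ i, Normalized (V i)) (hV : ∀ i, Nice (V i))
    (H : SharedSupportingProbs V w) {f : I → S → ℝ} (hint : Interior f) (hf : Feasible w f)
    (hfi : FullInsurance f) : CompetitiveEquilibriumWithTransfers V ω w f := by
  obtain ⟨p, hp⟩ := H f hf hfi
  rw [Set.mem_iInter] at hp
  obtain ⟨x, hx, rfl⟩ := hfi.eq_cst
  have hxpos : ∀ i, 0 < x i := fun i => hint i (Classical.arbitrary S)
  obtain ⟨j, -⟩ := exists_pos_of_sum_pos (hw.trans_eq (sum_eq_of_feasible_cst hf).symm)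
  have hp1 := (hp j).1.2
  -- The transfers give agent `i` wealth exactly `x i`, the cost of the constant bundle at prices
  -- `p`.
  refine ⟨hf, p, supportingProbs_pos (hn j) (hV j) (hxpos j) (hp j),
    fun i => x i - p ⬝ᵥ ω i, ?_, fun i => ⟨⟨hf.1 i, ?_⟩, fun g hg => ?_⟩⟩
  · rw [Finset.sum_sub_distrib, sum_eq_of_feasible_cst hf, ← dotProduct_sum, hagg,
      dotProduct_cst hp1, sub_self]
  · rw [dotProduct_cst hp1]; linarith
  · rw [hn i _ (hx i)]
    by_contra! hlt
    have h1 := lt_dotProduct_of_lt_of_pos (hn i) (hV i) (hxpos i) (hp i) hg.1 hlt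
    have h2 := hg.2
    linarith

end Economy

end RiskSharing

theorem corollary1 {I S : Type*} [Fintype I] [Fintype S] [Nonempty S]
    (V : I → (S → ℝ) → ℝ) (ω : I → S → ℝ) (w : ℝ)
    (hω : ∀ i, ω i ∈ orthant S) (hw : 0 < w) (hagg : ∑ i, ω i = cst S w)
    (hnorm : ∀ i, Normalized (V i))
    (hnice : ∀ i, Nice (V i))
    (hcs : ∀ i, ConstSuperadditive (V i))
    (hps : ∀ i, PosSubhomogeneous (V i))
    (hstrict : ∀ i, StrictConstSuperadditive (V i) ∨ StrictPosSubhomogeneous (V i)) :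
    List.TFAE
      [EfficientIsFullInsurance V w,
       FullInsuranceIsEfficient V w,
       SharedSupportingProbs V w] ∧
    ((EfficientIsFullInsurance V w ∨ FullInsuranceIsEfficient V w ∨ SharedSupportingProbs V w) →
      ∀ f : I → S → ℝ, Interior f → Feasible w f → FullInsurance f →
        CompetitiveEquilibriumWithTransfers V ω w f) := by
  have h12 : EfficientIsFullInsurance V w → FullInsuranceIsEfficient V w :=
    fun H => H.fullInsuranceIsEfficient hnorm hnice
  have h23 : FullInsuranceIsEfficient V w → SharedSupportingProbs V w :=
    fun H => H.sharedSupportingProbs hw hnorm hnice hcs hps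
  have h31 : SharedSupportingProbs V w → EfficientIsFullInsurance V w :=
    fun H => H.efficientIsFullInsurance hw hnorm hnice hcs hps hstrict
  refine ⟨?_, fun h f hint hf hfi => ?_⟩
  · tfae_have 1 → 2 := h12
    tfae_have 2 → 3 := h23
    tfae_have 3 → 1 := h31
    tfae_finish
  · have H : SharedSupportingProbs V w := by
      rcases h with h | h | h
      exacts [h23 (h12 h), h23 h, h]
    exact H.competitiveEquilibrium hw hagg hnorm hnice hint hf hfi
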